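/- For $n\ge 0$ let $P(n)$ be the symmetric Pascal matrix, the $n\times n$ integer matrix with entries $p_{i,j}=\binom{i+j}{i}$, $0\le i,j<n$, and let $\chi_n(t)=\det(tI-P(n))\in\mathbf{Z}[t]$ be its characteristic polynomial. Let $q=p^l$ ($l\ge 0$) be a power of a prime $p$, let $k$ be an integer with $0\le k\le q/2$, and let $\epsilon(q)\in\{-1,0,1\}$ be defined by $\epsilon(q)\equiv q\pmod 3$. Then $$\chi_{q-k}(t)\equiv (t^2+t+1)^{(q-\epsilon(q))/3-k}\,(t-1)^{(q+2\epsilon(q))/3-k}\,\det(t^2I+P(k))\pmod p.$$ Here the exponents are integers, possibly negative, and the congruence means equality in the field $\mathbf{F}_p(t)$ of rational functions after all polynomials are reduced modulo $p$. -/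

import Mathlib

open Polynomial

/-- The symmetric Pascal matrix `P(n)` of order `n`, with integer coefficients
`p_{i,j} = (i + j choose i)` for `0 ≤ i, j < n`. -/
def symmPascal (n : ℕ) : Matrix (Fin n) (Fin n) ℤ :=
  Matrix.of fun i j => (((i : ℕ) + (j : ℕ)).choose (i : ℕ) : ℤ)

/-- The characteristic polynomial `χ_n(t) = det (t I - P(n))`, in `ℤ[t]`. -/
noncomputable def symmPascalCharpoly (n : ℕ) : ℤ[X] :=
  (symmPascal n).charpoly

/-- The polynomial `det (t² I + P(n))`, in `ℤ[t]`. -/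
noncomputable def symmPascalDetSq (n : ℕ) : ℤ[X] :=
  ((X ^ 2 : ℤ[X]) • (1 : Matrix (Fin n) (Fin n) ℤ[X]) + (symmPascal n).map C).det

/-- Reduction modulo a prime `p`: an integer polynomial is viewed in the field `𝔽_p(t)` of rational
functions, by reducing its coefficients modulo `p` (this loses no information on the class modulo
`p`, as `𝔽_p[t]` embeds in `𝔽_p(t)`). Working in `𝔽_p(t)` gives a meaning to negative powers. -/
noncomputable def redMod (p : ℕ) [Fact p.Prime] : ℤ[X] →+* RatFunc (ZMod p) :=
  (algebraMap (ZMod p)[X] (RatFunc (ZMod p))).comp (mapRingHom (Int.castRingHom (ZMod p)))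

open Matrix Finset

/-! Put N = q - 1. Modulo p, (1 - X)^(N - i) agrees with (1 - X)^(-(i + 1)) up to X^q, so P(q)
reduces to the matrix S of the substitution X^i ↦ (1 - X)^(N - i). This is the N-th symmetric power
of a 2 × 2 matrix whose cube is -1, hence S^3 = 1 and (t - S)(t^2 + tS + S^2) = t^3 - 1.

Jacobi's identity on complementary minors relates the leading block of t - S, of determinant
χ_{q-k}, to the last k × k block of t^2 + tS + S^2. As 2k ≤ q, S vanishes on that block, while S^2
restricts to P(k) in reversed order. This gives χ_q · det(t^2 + P(k)) = χ_{q-k} · (t^3 - 1)^k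
(`charpoly_mul_det_sq`).

The eigenvalues of S follow by triangularising the 2 × 2 matrix; they group into full sets of cube
roots of unity, up to q mod 3 leftovers (`charpoly_symPowMatrix_eq_pow`). -/

/-- The matrix, on the monomial basis of polynomials of degree at most `N`, of the substitution
`X ^ i ↦ u ^ i * v ^ (N - i)`; for linear `u` and `v` this is a symmetric power. -/
noncomputable def symPowMatrix {R : Type*} [CommRing R] (N : ℕ) (u v : R[X]) :
    Matrix (Fin (N + 1)) (Fin (N + 1)) R :=
  Matrix.of fun i j => (u ^ (i : ℕ) * v ^ (N - (i : ℕ))).coeff j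

/-! ### Symmetric powers of 2 × 2 matrices -/

section SymPow

variable {R : Type*} [CommRing R]

/-- The homogeneous substitution `X ^ k ↦ u ^ k * v ^ (N - k)` is multiplicative in linear
factors. -/
lemma sum_coeff_linear_mul (N : ℕ) (a b : R) (f u v : R[X]) (hf : f.natDegree ≤ N) :
    ∑ k ∈ range (N + 2), C (((C a * X + C b) * f).coeff k) * (u ^ k * v ^ (N + 1 - k)) =
      (C a * u + C b * v) *
        ∑ k ∈ range (N + 1), C (f.coeff k) * (u ^ k * v ^ (N - k)) := by
  have h1 : ∑ k ∈ range (N + 2), C ((C a * X * f).coeff k) * (u ^ k * v ^ (N + 1 - k)) =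
      C a * u * ∑ k ∈ range (N + 1), C (f.coeff k) * (u ^ k * v ^ (N - k)) := by
    rw [sum_range_succ', mul_sum]
    have h0 : (C a * X * f).coeff 0 = 0 := by simp [mul_assoc]
    rw [h0, C_0, zero_mul, add_zero]
    refine sum_congr rfl fun k _ => ?_
    rw [mul_assoc (C a), coeff_C_mul, coeff_X_mul, C_mul, Nat.add_sub_add_right]
    ring
  have h2 : ∑ k ∈ range (N + 2), C ((C b * f).coeff k) * (u ^ k * v ^ (N + 1 - k)) =
      C b * v * ∑ k ∈ range (N + 1), C (f.coeff k) * (u ^ k * v ^ (N - k)) := by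
    rw [sum_range_succ, mul_sum, coeff_C_mul, coeff_eq_zero_of_natDegree_lt (by omega : _ < N + 1),
      mul_zero, C_0, zero_mul, add_zero]
    refine sum_congr rfl fun k hk => ?_
    have : N + 1 - k = (N - k) + 1 := by have := mem_range.1 hk; omega
    rw [coeff_C_mul, C_mul, this]
    ring
  rw [add_mul, add_mul, ← h1, ← h2, ← sum_add_distrib]
  refine sum_congr rfl fun k _ => ?_
  rw [coeff_add, C_add, add_mul]

lemma natDegree_linear_pow_mul_le (a b c d : R) (r s : ℕ) :
    ((C a * X + C b) ^ r * (C c * X + C d) ^ s).natDegree ≤ r + s := by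
  refine natDegree_mul_le.trans (add_le_add ?_ ?_)
  · simpa using natDegree_pow_le_of_le r (natDegree_linear_le (a := a) (b := b))
  · simpa using natDegree_pow_le_of_le s (natDegree_linear_le (a := c) (b := d))

lemma sum_coeff_linear_pow_mul (a b c d : R) (u v : R[X]) (r s : ℕ) :
    ∑ k ∈ range (r + s + 1),
        C (((C a * X + C b) ^ r * (C c * X + C d) ^ s).coeff k) * (u ^ k * v ^ (r + s - k)) =
      (C a * u + C b * v) ^ r * (C c * u + C d * v) ^ s := by
  induction r with
  | zero =>
    induction s with
    | zero => simp
    | succ s ih =>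
      have h := sum_coeff_linear_mul (0 + s) c d ((C a * X + C b) ^ 0 * (C c * X + C d) ^ s) u v
        (natDegree_linear_pow_mul_le ..)
      rw [ih] at h
      rw [pow_succ (C c * u + C d * v), ← mul_assoc, mul_comm _ (C c * u + C d * v), ← h]
      refine sum_congr rfl fun k _ => ?_
      congr 3
      ring
  | succ r ih =>
    have h := sum_coeff_linear_mul (r + s) a b ((C a * X + C b) ^ r * (C c * X + C d) ^ s) u v
      (natDegree_linear_pow_mul_le ..)
    rw [ih] at h
    rw [show r + 1 + s = r + s + 1 by ring, pow_succ' (C a * u + C b * v), mul_assoc, ← h]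
    refine sum_congr rfl fun k _ => ?_
    congr 3
    ring

/-- Functoriality of the symmetric power: matrix products are compositions of substitutions. -/
lemma symPowMatrix_mul (N : ℕ) (a b c d : R) (u v : R[X]) :
    symPowMatrix N (C a * X + C b) (C c * X + C d) * symPowMatrix N u v =
      symPowMatrix N (C a * u + C b * v) (C c * u + C d * v) := by
  ext i j
  have hi : (i : ℕ) + (N - i) = N := by omega
  have h := sum_coeff_linear_pow_mul a b c d u v i (N - i)
  rw [hi] at h
  simp only [symPowMatrix, Matrix.mul_apply, Matrix.of_apply]
  rw [← h, finsetSum_coeff, sum_range]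
  exact sum_congr rfl fun k _ => (coeff_C_mul _).symm

lemma symPowMatrix_X_one (N : ℕ) : symPowMatrix N (X : R[X]) 1 = 1 := by
  ext i j
  simp [symPowMatrix, coeff_X_pow, Matrix.one_apply, Fin.ext_iff, eq_comm]

lemma symPowMatrix_one_sub_sq (N : ℕ) :
    symPowMatrix N (1 : R[X]) (1 - X) * symPowMatrix N 1 (1 - X) =
      symPowMatrix N (1 - X) (-X) := by
  have h := symPowMatrix_mul N (0 : R) 1 (-1) 1 1 (1 - X)
  rw [show (C 0 * X + C 1 : R[X]) = 1 by simp,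
    show (C (-1) * X + C 1 : R[X]) = 1 - X by simp only [C_neg, C_1]; ring,
    show (C 0 * 1 + C 1 * (1 - X) : R[X]) = 1 - X by simp,
    show (C (-1) * 1 + C 1 * (1 - X) : R[X]) = -X by simp only [C_neg, C_1]; ring] at h
  exact h

lemma symPowMatrix_one_sub_cube (N : ℕ) (hN : (-1 : R) ^ N = 1) :
    symPowMatrix N (1 : R[X]) (1 - X) ^ 3 = 1 := by
  rw [pow_succ', sq, symPowMatrix_one_sub_sq]
  have h := symPowMatrix_mul N (0 : R) 1 (-1) 1 (1 - X) (-X)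
  simp only [C_0, C_1, C_neg, zero_mul, zero_add, one_mul, neg_mul] at h
  rw [show (1 - X : R[X]) = -X + 1 by ring] at h ⊢
  rw [h, ← symPowMatrix_X_one]
  ext i j
  have hi : (i : ℕ) + (N - i) = N := by omega
  have h1 : (-X : R[X]) ^ (i : ℕ) * (-(-X + 1) + -X) ^ (N - (i : ℕ)) = X ^ (i : ℕ) := by
    have h2 : (-1 : R[X]) ^ N = 1 := by
      rw [← C_1, ← C_neg, ← C_pow, hN]
    rw [show -(-X + 1) + -X = (-1 : R[X]) by ring, neg_pow, mul_right_comm, ← pow_add, hi, h2,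
      one_mul]
  simp only [symPowMatrix, Matrix.of_apply, h1, one_pow, mul_one]

/-- The hypothesis makes a a fixed point of x ↦ 1 / (1 - x). Conjugating by the translation that
moves a to 0 makes the substitution triangular. -/
lemma charpoly_symPowMatrix_one_sub (N : ℕ) (a : R) (ha : a ^ 2 - a + 1 = 0) :
    (symPowMatrix N (1 : R[X]) (1 - X)).charpoly =
      ∏ i ∈ range (N + 1), (X - C (a ^ i * (1 - a) ^ (N - i))) := by
  have hU (c : R) : symPowMatrix N (X + C c) 1 * symPowMatrix N (X + C (-c)) 1 = 1 := by
    have h := symPowMatrix_mul N 1 c 0 1 (X + C (-c)) 1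
    simp only [C_0, C_1, zero_mul, zero_add, one_mul, mul_one, C_neg] at h
    rw [C_neg, h, ← symPowMatrix_X_one]
    congr 1
    ring
  have h1 := symPowMatrix_mul N 1 (-a) 0 1 1 (1 - X)
  have h2 := symPowMatrix_mul N a 0 (-1) (1 - a) (X + C (-a)) 1
  have ha' : (C a ^ 2 - C a + 1 : R[X]) = 0 := by
    rw [← C_pow, ← C_sub, ← C_1, ← C_add, ha, C_0]
  have h12 : symPowMatrix N (X + C (-a)) 1 * symPowMatrix N 1 (1 - X) =
      symPowMatrix N (C a * X) (C (-1) * X + C (1 - a)) * symPowMatrix N (X + C (-a)) 1 := by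
    simp only [C_0, C_1, zero_mul, zero_add, one_mul, mul_one, add_zero] at h1 h2
    rw [h1, h2]
    congr 1
    · simp only [C_neg]
      linear_combination ha'
    · simp only [C_neg, C_sub, C_1]
      ring
  have hconj : symPowMatrix N (1 : R[X]) (1 - X) = symPowMatrix N (X + C a) 1 *
      symPowMatrix N (C a * X) (C (-1) * X + C (1 - a)) * symPowMatrix N (X + C (-a)) 1 := by
    rw [mul_assoc, ← h12, ← mul_assoc, hU, one_mul]
  have hU' : symPowMatrix N (X + C (-a)) 1 * symPowMatrix N (X + C a) 1 = 1 := by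
    simpa using hU (-a)
  rw [hconj, Matrix.charpoly_mul_comm, ← mul_assoc, hU', one_mul, Matrix.charpoly_of_isUpperTriangular,
    prod_range]
  · refine prod_congr rfl fun i _ => ?_
    simp only [symPowMatrix, Matrix.of_apply]
    congr 2
    rw [mul_pow, mul_right_comm, ← C_pow, mul_assoc, coeff_C_mul, coeff_mul_X_pow', if_pos le_rfl,
      Nat.sub_self, coeff_zero_eq_eval_zero]
    simp
  · intro i j hij
    have : (j : ℕ) < i := hij
    simp only [symPowMatrix, Matrix.of_apply]
    rw [mul_pow, mul_right_comm, coeff_mul_X_pow', if_neg (by omega)]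

lemma prod_X_sub_C_eq (a : R) (ha : a ^ 2 - a + 1 = 0) (q s r : ℕ)
    (hq : q = 3 * s + r) (hr : 0 < q) (hN : (-1 : R) ^ (q - 1) = 1) :
    ∏ i ∈ range q, (X - C (a ^ i * (1 - a) ^ (q - 1 - i))) =
      (X ^ 3 - 1) ^ s * ∏ i ∈ range r, (X - C (a ^ (3 * s + i) * (1 - a) ^ (q - 1 - (3 * s + i)))) := by
  have ha3 : a ^ 3 = -1 := by linear_combination (a + 1) * ha
  have hb3 : (1 - a) ^ 3 = -1 := by linear_combination (2 - a) * ha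
  have key (s : ℕ) (hs : 3 * s ≤ q) :
      ∏ i ∈ range (3 * s), (X - C (a ^ i * (1 - a) ^ (q - 1 - i))) = (X ^ 3 - 1) ^ s := by
    induction s with
    | zero => simp
    | succ s ih =>
      rw [show 3 * (s + 1) = 3 * s + 1 + 1 + 1 by ring, prod_range_succ, prod_range_succ,
        prod_range_succ, ih (by omega), pow_succ (X ^ 3 - 1 : R[X]), mul_assoc, mul_assoc]
      congr 1
      obtain ⟨t, ht⟩ : ∃ t, q - 1 = 3 * s + 2 + t := ⟨q - 1 - (3 * s + 2), by omega⟩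
      have e0 : q - 1 - 3 * s = t + 2 := by omega
      have e1 : q - 1 - (3 * s + 1) = t + 1 := by omega
      have e2 : q - 1 - (3 * s + 1 + 1) = t := by omega
      rw [e0, e1, e2]
      -- Three consecutive roots are -ca, c and c(a - 1), with c^3 = 1; their factors multiply to
      -- X^3 - c^3.
      set c := a ^ (3 * s) * (1 - a) ^ t with hc
      have hab : a * (1 - a) = 1 := by linear_combination -ha
      have hc3 : c ^ 3 = 1 := by
        have : c ^ 3 = (-1) ^ (3 * s + t) := by
          rw [hc, mul_pow, ← pow_mul, ← pow_mul, mul_comm _ 3, mul_comm t,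
            pow_mul, pow_mul (1 - a), ha3, hb3, pow_add]
        rw [ht, show 3 * s + 2 + t = 3 * s + t + 2 by ring, pow_add _ _ 2, neg_one_sq,
          mul_one] at hN
        rw [this, hN]
      have f0 : a ^ (3 * s) * (1 - a) ^ (t + 2) = -(c * a) := by
        rw [hc]; linear_combination (a ^ (3 * s) * (1 - a) ^ t) * ha
      have f1 : a ^ (3 * s + 1) * (1 - a) ^ (t + 1) = c := by
        rw [hc]; linear_combination (a ^ (3 * s) * (1 - a) ^ t) * hab
      have f2 : a ^ (3 * s + 1 + 1) * (1 - a) ^ t = c * (a - 1) := by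
        rw [hc]; linear_combination (a ^ (3 * s) * (1 - a) ^ t) * ha
      rw [f0, f1, f2]
      have ha' : (C a ^ 2 - C a + 1 : R[X]) = 0 := by
        rw [← C_pow, ← C_sub, ← C_1, ← C_add, ha, C_0]
      have hc' : (C c ^ 3 : R[X]) = 1 := by rw [← C_pow, hc3, C_1]
      simp only [C_neg, C_mul, C_sub, C_1]
      linear_combination (-1 : R[X]) * hc' + (C c ^ 3 - X * C c ^ 2) * ha'
  subst hq
  rw [prod_range_add, key s (by omega)]

end SymPow

/-- A form of Jacobi's identity on complementary minors. -/
lemma det_mul_det_submatrix_of_mul_eq_smul {R m n o : Type*} [CommRing R] [Fintype m] [Fintype n]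
    [Fintype o] [DecidableEq m] [DecidableEq n] [DecidableEq o] (e : m ⊕ n ≃ o)
    (M N : Matrix o o R) (c : R) (h : M * N = c • 1) :
    M.det * (N.submatrix (e ∘ Sum.inr) (e ∘ Sum.inr)).det =
      (M.submatrix (e ∘ Sum.inl) (e ∘ Sum.inl)).det * c ^ Fintype.card n := by
  set M' := M.submatrix e e with hM'
  set N' := N.submatrix e e with hN'
  have h' : M' * N' = c • 1 := by
    rw [hM', hN', Matrix.submatrix_mul_equiv, h]
    ext i j
    simp [Matrix.one_apply]
  have hN2 : N.submatrix (e ∘ Sum.inr) (e ∘ Sum.inr) = N'.toBlocks₂₂ := rfl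
  have hM1 : M.submatrix (e ∘ Sum.inl) (e ∘ Sum.inl) = M'.toBlocks₁₁ := rfl
  rw [← Matrix.fromBlocks_toBlocks M', ← Matrix.fromBlocks_toBlocks N',
    Matrix.fromBlocks_multiply, ← Matrix.fromBlocks_one, Matrix.fromBlocks_smul,
    Matrix.fromBlocks_inj] at h'
  -- Replacing the first block column of N' by that of the identity makes the product block
  -- triangular.
  have key : M' * Matrix.fromBlocks 1 N'.toBlocks₁₂ 0 N'.toBlocks₂₂ =
      Matrix.fromBlocks M'.toBlocks₁₁ 0 M'.toBlocks₂₁ (c • 1) := by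
    conv_lhs => rw [← Matrix.fromBlocks_toBlocks M']
    rw [Matrix.fromBlocks_multiply, h'.2.1, h'.2.2.2]
    simp
  have hdet := congrArg Matrix.det key
  rw [Matrix.det_mul, Matrix.det_fromBlocks_zero₂₁, Matrix.det_fromBlocks_zero₁₂, Matrix.det_one,
    one_mul, Matrix.det_smul, Matrix.det_one, mul_one, hM', Matrix.det_submatrix_equiv_self] at hdet
  rw [hN2, hM1, hdet, hM']

/-! ### Pascal matrices modulo p as blocks of S and S^2 -/

section CharP

variable {F : Type*} [Field F] (p : ℕ) [Fact p.Prime] [CharP F p]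

lemma coeff_one_sub_X_pow_eq_choose {N l : ℕ} (hq : N + 1 = p ^ l) {i j : ℕ} (hi : i ≤ N)
    (hj : j ≤ N) : ((1 - X : F[X]) ^ (N - i)).coeff j = ((i + j).choose i : F) := by
  have : CharP F[X] p := inferInstance
  have h1 : (1 - X : F[X]) ^ (N + 1) = 1 - X ^ (N + 1) := by
    rw [hq, sub_pow_char_pow, one_pow]
  have h2 : ((1 - X : F[X]) ^ (N + 1) : F[X]) = (1 - X) ^ (N - i) * (1 - X) ^ (i + 1) := by
    rw [← pow_add]; congr 1; omega
  have h3 : (((1 - X : F[X]) ^ (N - i) : F[X]) : PowerSeries F) =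
      PowerSeries.mk (fun n => ((i + n).choose i : F)) * (1 - PowerSeries.X ^ (N + 1)) := by
    have h4 : (((1 - X : F[X]) ^ (N - i) : F[X]) : PowerSeries F) *
        (1 - PowerSeries.X) ^ (i + 1) = 1 - PowerSeries.X ^ (N + 1) := by
      have := congrArg (Polynomial.coeToPowerSeries.ringHom (R := F)) (h2.symm.trans h1)
      simpa using this
    rw [← h4, ← PowerSeries.mk_one_pow_eq_mk_choose_add, mul_left_comm, ← mul_pow,
      PowerSeries.mk_one_mul_one_sub_eq_one, one_pow, mul_one]
  rw [← Polynomial.coeff_coe, h3, mul_sub, mul_one, map_sub, PowerSeries.coeff_mk,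
    PowerSeries.coeff_mul_X_pow', if_neg (by omega), sub_zero]

/-- For p = 2 the exponent can be odd, but then -1 = 1. -/
lemma neg_one_pow_eq_one_of_succ_eq {N l : ℕ} (hq : N + 1 = p ^ l) : (-1 : F) ^ N = 1 := by
  have h := neg_one_pow_char_pow F p l
  rw [← hq, pow_succ] at h
  linear_combination -h

lemma map_symmPascal_eq_submatrix {N l m : ℕ} (hq : N + 1 = p ^ l) (f : Fin m → Fin (N + 1))
    (hf : ∀ i, (f i : ℕ) = i) :
    (symmPascal m).map (Int.castRingHom F) =
      (symPowMatrix N (1 : F[X]) (1 - X)).submatrix f f := by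
  ext i j
  simp only [symmPascal, symPowMatrix, Matrix.map_apply, Matrix.of_apply, Matrix.submatrix_apply,
    hf, one_pow, one_mul]
  have hi := (f i).is_lt
  have hj := (f j).is_lt
  rw [hf] at hi hj
  rw [coeff_one_sub_X_pow_eq_choose p hq (by omega) (by omega)]
  simp

/-- Row i has degree at most N - i < k, while k ≤ j because 2k ≤ N + 1. -/
lemma symPowMatrix_one_sub_apply_eq_zero {N k : ℕ} (hk : 2 * k ≤ N + 1) (i j : Fin (N + 1))
    (hi : N < i + k) (hj : N < j + k) : symPowMatrix N (1 : F[X]) (1 - X) i j = 0 := by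
  simp only [symPowMatrix, Matrix.of_apply, one_pow, one_mul]
  refine coeff_eq_zero_of_natDegree_lt (lt_of_le_of_lt (b := N - (i : ℕ)) ?_ (by omega))
  simpa using natDegree_pow_le_of_le (N - (i : ℕ))
    (show (1 - X : F[X]).natDegree ≤ 1 by compute_degree)

lemma symPowMatrix_sq_apply {N l k : ℕ} (hq : N + 1 = p ^ l) (hk : 2 * k ≤ N + 1)
    (i j : Fin (N + 1)) (a b : ℕ) (ha : a < k) (hb : b < k) (hi : (i : ℕ) = N - a)
    (hj : (j : ℕ) = N - b) :
    (symPowMatrix N (1 : F[X]) (1 - X) ^ 2) i j = ((a + b).choose a : F) := by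
  rw [sq, symPowMatrix_one_sub_sq]
  simp only [symPowMatrix, Matrix.of_apply, hi, hj]
  rw [show N - (N - a) = a by omega, neg_pow (X : F[X]), ← C_1, ← C_neg, ← C_pow, mul_left_comm,
    coeff_C_mul, coeff_mul_X_pow', if_pos (by omega), C_1,
    ← coeff_one_sub_X_pow_eq_choose p hq (by omega : a ≤ N) (by omega : b ≤ N)]
  have hcoeff (n r : ℕ) : ((1 - X : F[X]) ^ n).coeff r = (-1) ^ r * (n.choose r : F) := by
    have h := coeff_X_add_C_pow (-1 : F) n r
    rw [show (1 - X : F[X]) = C (-1) * (X + C (-1)) by simp only [C_neg, C_1]; ring, mul_pow,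
      ← C_pow, coeff_C_mul, h]
    rcases le_or_gt r n with hr | hr
    · rw [← mul_assoc, ← pow_add,
        show n + (n - r) = r + 2 * (n - r) by omega, pow_add, pow_mul]
      simp
    · simp [Nat.choose_eq_zero_of_lt hr]
  rw [hcoeff, hcoeff, ← mul_assoc, ← pow_add, show a + (N - b - a) = N - b by omega,
    show N - b - a = N - a - b by omega, Nat.choose_symm (by omega)]
  congr 1
  have h1 : (-1 : F) ^ (N - b) * (-1) ^ b = 1 := by
    rw [← pow_add, Nat.sub_add_cancel (by omega), neg_one_pow_eq_one_of_succ_eq p hq]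
  have h2 : (-1 : F) ^ b * (-1) ^ b = 1 := by rw [← mul_pow]; simp
  linear_combination (-1) ^ b * h1 - (-1) ^ (N - b) * h2

end CharP

/-! ### Complementary minors, eigenvalues and conclusion -/

lemma charpoly_mul_det_sq (p : ℕ) [Fact p.Prime] {N l k m : ℕ} (hq : N + 1 = p ^ l)
    (hk : 2 * k ≤ N + 1) (hm : m + k = N + 1) :
    (symPowMatrix N (1 : (ZMod p)[X]) (1 - X)).charpoly *
        (symmPascalDetSq k).map (Int.castRingHom (ZMod p)) =
      (symmPascalCharpoly m).map (Int.castRingHom (ZMod p)) * (X ^ 3 - 1) ^ k := by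
  set S := symPowMatrix N (1 : (ZMod p)[X]) (1 - X) with hS
  set T : Matrix (Fin (N + 1)) (Fin (N + 1)) (ZMod p)[X] :=
    (C : ZMod p →+* (ZMod p)[X]).mapMatrix S with hT
  have hT3 : T ^ 3 = 1 := by
    rw [hT, ← map_pow, hS,
      symPowMatrix_one_sub_cube N (neg_one_pow_eq_one_of_succ_eq (F := ZMod p) p hq), map_one]
  have hmul : S.charmatrix * ((X ^ 2 : (ZMod p)[X]) • (1 : Matrix _ _ _) +
      (X : (ZMod p)[X]) • T + T ^ 2) = (X ^ 3 - 1 : (ZMod p)[X]) • 1 := by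
    have hc : S.charmatrix = (X : (ZMod p)[X]) • (1 : Matrix _ _ _) - T := by
      rw [Matrix.charmatrix, Matrix.smul_one_eq_diagonal, Matrix.scalar_apply]
    have hT3' : T * T ^ 2 = 1 := by rw [← pow_succ', hT3]
    rw [hc, sub_mul, mul_add, mul_add, mul_add, mul_add, hT3']
    simp only [smul_mul_assoc, mul_smul_comm, one_mul, mul_one, smul_smul, sub_smul, one_smul]
    rw [← sq T, ← pow_succ, ← sq X]
    abel
  -- The last k indices are reversed so that the corner of S^2 is P(k) itself.
  let e : Fin m ⊕ Fin k ≃ Fin (N + 1) :=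
    ((Equiv.refl _).sumCongr Fin.revPerm).trans (finSumFinEquiv.trans (finCongr hm))
  have hel (i : Fin m) : (e (Sum.inl i) : ℕ) = i := by simp [e]
  have her (i : Fin k) : (e (Sum.inr i) : ℕ) = N - i := by
    simp [e, Fin.val_rev]; omega
  have h := det_mul_det_submatrix_of_mul_eq_smul e _ _ _ hmul
  rw [Fintype.card_fin] at h
  have h1 : (symmPascalCharpoly m).map (Int.castRingHom (ZMod p)) =
      (S.charmatrix.submatrix (e ∘ Sum.inl) (e ∘ Sum.inl)).det := by
    rw [symmPascalCharpoly, ← Matrix.charpoly_map,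
      map_symmPascal_eq_submatrix p hq (e ∘ Sum.inl) hel, Matrix.charpoly]
    congr 1
    ext1 i j
    simp only [Matrix.charmatrix_apply, Matrix.submatrix_apply, Matrix.diagonal_apply,
      Function.comp_apply, e.injective.eq_iff, Sum.inl.injEq, hS]
  have h2 : (symmPascalDetSq k).map (Int.castRingHom (ZMod p)) =
      (((X ^ 2 : (ZMod p)[X]) • (1 : Matrix _ _ _) + (X : (ZMod p)[X]) • T + T ^ 2).submatrix
        (e ∘ Sum.inr) (e ∘ Sum.inr)).det := by
    rw [symmPascalDetSq, ← coe_mapRingHom, RingHom.map_det]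
    congr 1
    ext1 i j
    have hT2 : T ^ 2 = (S ^ 2).map C := by rw [hT, ← map_pow, RingHom.mapMatrix_apply]
    have hz : S (e (Sum.inr i)) (e (Sum.inr j)) = 0 :=
      symPowMatrix_one_sub_apply_eq_zero hk _ _ (by rw [her]; omega) (by rw [her]; omega)
    have hs : (S ^ 2) (e (Sum.inr i)) (e (Sum.inr j)) = (((i : ℕ) + j).choose i : ZMod p) :=
      symPowMatrix_sq_apply p hq hk _ _ i j i.2 j.2 (her i) (her j)
    have hT1 : T (e (Sum.inr i)) (e (Sum.inr j)) = 0 := by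
      rw [hT, RingHom.mapMatrix_apply, Matrix.map_apply, hz, C_0]
    simp only [hT2, hT1, Matrix.submatrix_apply, Matrix.add_apply, Matrix.smul_apply,
      Matrix.map_apply, Function.comp_apply, hs, Matrix.one_apply, e.injective.eq_iff,
      Sum.inr.injEq, RingHom.mapMatrix_apply, symmPascal, Matrix.of_apply]
    split_ifs <;> simp
  rw [h1, h2, ← h, Matrix.charpoly]

lemma charpoly_symPowMatrix_eq_pow (p : ℕ) [Fact p.Prime] {N l : ℕ} (hq : N + 1 = p ^ l) (s r : ℕ)
    (hs : N + 1 = 3 * s + r) (hr : r < 3) :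
    (symPowMatrix N (1 : (ZMod p)[X]) (1 - X)).charpoly =
      (X ^ 3 - 1) ^ s * (if r = 0 then 1 else if r = 1 then X - 1 else X ^ 2 + X + 1) := by
  let K := AlgebraicClosure (ZMod p)
  have : CharP K p := charP_of_injective_algebraMap (algebraMap (ZMod p) K).injective p
  obtain ⟨a, ha⟩ : ∃ a : K, a ^ 2 - a + 1 = 0 := by
    obtain ⟨a, ha⟩ := IsAlgClosed.exists_root (X ^ 2 - X + 1 : K[X]) (by
      rw [show (X ^ 2 - X + 1 : K[X]).degree = 2 by compute_degree!]; decide)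
    exact ⟨a, by simpa using ha⟩
  have hN := neg_one_pow_eq_one_of_succ_eq (F := K) p hq
  have ha3 : a ^ 3 = -1 := by linear_combination (a + 1) * ha
  have ha' : (C a ^ 2 - C a + 1 : K[X]) = 0 := by
    rw [← C_pow, ← C_sub, ← C_1, ← C_add, ha, C_0]
  apply map_injective _ (algebraMap (ZMod p) K).injective
  have hmap : (symPowMatrix N (1 : (ZMod p)[X]) (1 - X)).map (algebraMap (ZMod p) K) =
      symPowMatrix N 1 (1 - X) := by
    ext i j
    simp only [symPowMatrix, Matrix.map_apply, Matrix.of_apply]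
    rw [← coeff_map]
    simp
  rw [← Matrix.charpoly_map, hmap, charpoly_symPowMatrix_one_sub N a ha]
  have h := prod_X_sub_C_eq a ha (N + 1) s r hs (by omega) hN
  rw [Nat.add_sub_cancel] at h
  rw [h]
  interval_cases r
  · simp
  · have h3 : N = 3 * s := by omega
    rw [h3, pow_mul, Odd.neg_one_pow (by decide : Odd 3)] at hN
    have hc : a ^ (3 * s) = 1 := by rw [pow_mul, ha3, hN]
    subst h3
    rw [prod_range_one, add_zero, hc, Nat.sub_self, pow_zero, mul_one, C_1]
    simp
  · have h3 : N = 3 * s + 1 := by omega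
    rw [h3, pow_succ, pow_mul, Odd.neg_one_pow (by decide : Odd 3)] at hN
    have hs1 : (-1 : K) ^ s = -1 := by linear_combination -hN
    have hc : a ^ (3 * s) = -1 := by rw [pow_mul, ha3, hs1]
    subst h3
    rw [prod_range_succ, prod_range_one, add_zero, pow_succ a, hc, Nat.sub_self, pow_zero,
      Nat.add_sub_cancel_left, pow_one]
    simp only [C_mul, C_neg, C_sub, C_1, OfNat.ofNat_ne_zero, OfNat.ofNat_ne_one, if_false,
      Polynomial.map_mul, Polynomial.map_pow, Polynomial.map_sub, Polynomial.map_add, map_X,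
      Polynomial.map_one]
    linear_combination (-(X ^ 3 - 1 : K[X]) ^ s) * ha'

theorem theorem1p3 (p : ℕ) [Fact p.Prime] (l q : ℕ) (hq : q = p ^ l) (k : ℕ) (hk : 2 * k ≤ q)
    (ε : ℤ) (hε : ε = -1 ∨ ε = 0 ∨ ε = 1) (hεq : ε ≡ (q : ℤ) [ZMOD 3]) :
    redMod p (symmPascalCharpoly (q - k)) =
      redMod p (X ^ 2 + X + 1) ^ (((q : ℤ) - ε) / 3 - (k : ℤ)) *
        redMod p (X - 1) ^ (((q : ℤ) + 2 * ε) / 3 - (k : ℤ)) *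
          redMod p (symmPascalDetSq k) := by
  have hpos : 0 < q := hq ▸ pow_pos (Fact.out : p.Prime).pos l
  obtain ⟨N, rfl⟩ : ∃ N, q = N + 1 := ⟨q - 1, by omega⟩
  have hmain := charpoly_mul_det_sq p hq hk (m := N + 1 - k) (by omega)
  rw [charpoly_symPowMatrix_eq_pow p hq ((N + 1) / 3) ((N + 1) % 3) (by omega) (by omega)] at hmain
  replace hmain := congrArg (algebraMap (ZMod p)[X] (RatFunc (ZMod p))) hmain
  simp only [map_mul] at hmain
  have hred (f : ℤ[X]) : algebraMap (ZMod p)[X] (RatFunc (ZMod p))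
      (f.map (Int.castRingHom (ZMod p))) = redMod p f := rfl
  rw [hred, hred] at hmain
  set u := redMod p (X ^ 2 + X + 1) with hu
  set v := redMod p (X - 1) with hv
  have hinj := RatFunc.algebraMap_injective (ZMod p)
  have hu' : algebraMap (ZMod p)[X] (RatFunc (ZMod p)) (X ^ 2 + X + 1) = u := by
    simp [hu, redMod]
  have hv' : algebraMap (ZMod p)[X] (RatFunc (ZMod p)) (X - 1) = v := by
    simp [hv, redMod]
  have hu0 : u ≠ 0 := by
    rw [← hu', map_ne_zero_iff _ hinj]
    exact Monic.ne_zero (by monicity!)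
  have hv0 : v ≠ 0 := by
    rw [← hv', map_ne_zero_iff _ hinj]
    exact Monic.ne_zero (by monicity!)
  have huv : algebraMap (ZMod p)[X] (RatFunc (ZMod p)) (X ^ 3 - 1) = u * v := by
    rw [← hu', ← hv', ← map_mul]
    congr 1
    ring
  rw [map_pow, map_pow, huv] at hmain
  -- Multiplying by (uv)^k removes -k from the exponents, leaving nonnegative ones.
  refine mul_right_cancel₀ (pow_ne_zero k (mul_ne_zero hu0 hv0)) (hmain.symm.trans ?_)
  have huk (n : ℤ) : u ^ (n - k) * u ^ k = u ^ n := by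
    rw [← zpow_natCast, ← zpow_add₀ hu0, sub_add_cancel]
  have hvk (n : ℤ) : v ^ (n - k) * v ^ k = v ^ n := by
    rw [← zpow_natCast, ← zpow_add₀ hv0, sub_add_cancel]
  rw [mul_pow u v k]
  calc _ = u ^ ((((N + 1 : ℕ) : ℤ) - ε) / 3) * v ^ ((((N + 1 : ℕ) : ℤ) + 2 * ε) / 3) *
        redMod p (symmPascalDetSq k) := by
        congr 1
        rw [Int.ModEq] at hεq
        generalize hs : (N + 1) / 3 = s
        have h3 : (N + 1) % 3 = 0 ∨ (N + 1) % 3 = 1 ∨ (N + 1) % 3 = 2 := by omega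
        rcases h3 with h | h | h
        · rw [show (((N + 1 : ℕ) : ℤ) - ε) / 3 = (s : ℕ) by omega,
            show (((N + 1 : ℕ) : ℤ) + 2 * ε) / 3 = (s : ℕ) by omega]
          simp [h, mul_pow]
        · rw [show (((N + 1 : ℕ) : ℤ) - ε) / 3 = (s : ℕ) by omega,
            show (((N + 1 : ℕ) : ℤ) + 2 * ε) / 3 = (s + 1 : ℕ) by omega, zpow_natCast, zpow_natCast]
          simp only [h, one_ne_zero, if_false, if_true, hv']
          ring
        · rw [show (((N + 1 : ℕ) : ℤ) - ε) / 3 = (s + 1 : ℕ) by omega,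
            show (((N + 1 : ℕ) : ℤ) + 2 * ε) / 3 = (s : ℕ) by omega, zpow_natCast, zpow_natCast]
          simp only [h, OfNat.ofNat_ne_zero, OfNat.ofNat_ne_one, if_false, hu']
          ring
    _ = _ := by
        rw [← huk, ← hvk]
        ring
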